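/- Let $G$ be a group with a finite generating set $A$, let $d$ be the word metric on $G$ with respect to $A$, and let $\Gamma=\Gamma(G,A)$ be the Cayley graph of $G$ with its path metric. Put $(y|z)_x=\frac12\bigl(d(x,y)+d(x,z)-d(y,z)\bigr)$. The group $G$ is word hyperbolic if for some $\delta\ge 0$ all geodesic triangles in $\Gamma$ are $\delta$-thin, that is, for any geodesics $[x,y]$ and $[x,z]$ issuing from a common point $x$, any two points $O\in[x,y]$ and $O'\in[x,z]$ with $d(x,O)=d(x,O')\le (y|z)_x$ satisfy $d(O,O')\le\delta$. A subgroup $H\le G$ is quasiconvex if for some $\varepsilon\ge 0$ every geodesic in $\Gamma$ with endpoints in $H$ lies in the closed $\varepsilon$-neighbourhood of $H$. The profinite topology on $G$ is the one in which the cosets $xN$ of the normal subgroups $N$ of finite index form a basis of neighbourhoods of each $x\in G$; a subset of $G$ is separable if it is closed in this topology. A word hyperbolic group is GFERF if each of its quasiconvex subgroups is separable. Theorem. Assume that $G$ is a GFERF word hyperbolic group and that $G_1,G_2,\dots,G_s$ are finitely many quasiconvex subgroups of $G$. Then the product $G_1G_2\cdots G_s=\{g_1g_2\cdots g_s : g_i\in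 G_i\}$ is separable in $G$. -/

import Mathlib

open scoped Pointwise

namespace GFERF

variable {G : Type*} [Group G]

/-- The word metric `d(x, y) = |x⁻¹ y|` of `G` with respect to `A`: the path metric on the vertices
of the Cayley graph, in which `u ≠ v` are joined by an edge iff `v = u * a` with
`a ∈ A` or `a⁻¹ ∈ A` (so `A` is symmetrized by the Cayley graph). -/
noncomputable def wordDist (A : Set G) (x y : G) : ℕ :=
  (SimpleGraph.mulCayley A).dist x y

/-- A geodesic of the Cayley graph between two vertices: an edge path whose length is the distance
of its endpoints. -/
def IsGeodesic {A : Set G} {x y : G} (p : (SimpleGraph.mulCayley A).Walk x y) : Prop :=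
  p.length = wordDist A x y

/-- The Gromov product `(x | y)_w`. -/
noncomputable def gromovProduct (A : Set G) (x y w : G) : ℝ :=
  ((wordDist A x w : ℝ) + (wordDist A y w : ℝ) - (wordDist A x y : ℝ)) / 2

/-- Geodesic triangles of the Cayley graph are `δ`-thin: points on the sides `[x, y]` and `[x, z]`
that are at the same distance `n ≤ (y | z)_x` from the corner `x` are at distance at most `δ`. The
corner `x` is arbitrary, so this covers all three corners of each triangle. -/
def ThinTriangles (A : Set G) (δ : ℝ) : Prop :=
  ∀ (x y z : G) (p : (SimpleGraph.mulCayley A).Walk x y) (q : (SimpleGraph.mulCayley A).Walk x z),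
    IsGeodesic p → IsGeodesic q →
      ∀ n : ℕ, (n : ℝ) ≤ gromovProduct A y z x →
        (wordDist A (p.getVert n) (q.getVert n) : ℝ) ≤ δ

/-- `G` is word hyperbolic, `A` being a finite generating set of it. -/
structure IsWordHyperbolic (A : Set G) : Prop where
  finite : A.Finite
  closure_eq_top : Subgroup.closure A = ⊤
  exists_thin : ∃ δ : ℝ, 0 ≤ δ ∧ ThinTriangles A δ

/-- `Q` is quasiconvex: for some `ε ≥ 0`, each geodesic of the Cayley graph with endpoints in `Q`
lies in the closed `ε`-neighbourhood of `Q`. -/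
def IsQuasiconvex (A : Set G) (Q : Set G) : Prop :=
  ∃ ε : ℝ, 0 ≤ ε ∧
    ∀ u ∈ Q, ∀ v ∈ Q, ∀ p : (SimpleGraph.mulCayley A).Walk u v, IsGeodesic p →
      ∀ w ∈ p.support, ∃ t ∈ Q, (wordDist A w t : ℝ) ≤ ε

variable (G) in
/-- The profinite topology on `G`: the cosets `x N` of the normal subgroups `N` of finite index
form a basis of neighbourhoods of `x`. -/
abbrev profiniteTopology : TopologicalSpace G where
  IsOpen U := ∀ x ∈ U, ∃ N : Subgroup G, N.Normal ∧ N.FiniteIndex ∧ ∀ n ∈ N, x * n ∈ U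
  isOpen_univ := fun _ _ => ⟨⊤, inferInstance, inferInstance, fun _ _ => Set.mem_univ _⟩
  isOpen_inter := by
    rintro U V hU hV x ⟨hxU, hxV⟩
    obtain ⟨M, hM, hMf, hMU⟩ := hU x hxU
    obtain ⟨N, hN, hNf, hNV⟩ := hV x hxV
    exact ⟨M ⊓ N, inferInstance, inferInstance, fun n hn => ⟨hMU n hn.1, hNV n hn.2⟩⟩
  isOpen_sUnion := by
    rintro S hS x ⟨U, hUS, hxU⟩
    obtain ⟨N, hN, hNf, hNU⟩ := hS U hUS x hxU
    exact ⟨N, hN, hNf, fun n hn => ⟨U, hUS, hNU n hn⟩⟩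

/-- A subset of `G` is separable if it is closed in the profinite topology on `G`. -/
def IsSeparableSubset (P : Set G) : Prop :=
  @IsClosed G (profiniteTopology G) P

/-- `G`, with the finite generating set `A`, is a GFERF word hyperbolic group: it is word hyperbolic
and each of its quasiconvex subgroups is separable. -/
structure IsGFERF (A : Set G) : Prop where
  hyperbolic : IsWordHyperbolic A
  separable : ∀ H : Subgroup G, IsQuasiconvex A (H : Set G) → IsSeparableSubset (H : Set G)

end GFERF

open scoped Pointwise

namespace GFERF

variable {G : Type*} [Group G]

/-! Induct on the number of factors. To separate `g` from `H K P`, with `P` the product of the other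
factors, take a finite-index subgroup `N` containing `D = H ⊓ K` and let `L` be generated by `H ⊓ N`
and `K ⊓ N`. Finitely many sets `s L s'⁻¹ P` cover `H K P`. If elements of `H ⊓ N` and `K ⊓ N`
outside `D` are long, then `L` is quasiconvex (`CoarseQC.sup_inf`): a shortest alternating word
traces a path with long inner edges and bounded Gromov products at its corners
(`HypDist.exists_backtrack_bound`), so geodesics follow it. As `L` replaces two factors by one,
induction makes the covering sets separable.

It remains to choose `N` so that none of them contains `g`. Otherwise write `g` as an alternating
word times an element of `P`, with the word shortest possible. If it has more than two letters, both
ends of its second edge lie close to a polygon labelled by `P` (`HypDist.exists_two_near_sides`), so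
the inverse of that letter lies in one of finitely many sets `X = a⁻¹ Q b`, with `Q` a product over
a sublist. By induction `X D` is separable, so `N` can be chosen to meet `X` only if `D` does
(`exists_finiteIndex_of_separable`). The letter can then be replaced by an element of `D` and
absorbed by its neighbours, contrary to minimality. So the word has two letters and `g ∈ H K P`. -/

/-- A left-invariant, integer-valued, proper and geodesic distance on a group, which satisfies
Gromov's four-point condition with the (additive) constant `δ`. -/
structure HypDist (d : G → G → ℕ) (δ : ℕ) : Prop where
  self : ∀ x, d x x = 0
  comm : ∀ x y, d x y = d y x
  tri : ∀ x y z, d x z ≤ d x y + d y z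
  mul_left : ∀ g x y, d (g * x) (g * y) = d x y
  finite_ball : ∀ r, {x | d 1 x ≤ r}.Finite
  exists_between : ∀ x y n, n ≤ d x y → ∃ w, d x w = n ∧ d x w + d w y = d x y
  four_point : ∀ x y z w,
    d x z + d w y ≤ d w x + d y z + δ ∨ d x z + d w y ≤ d w z + d x y + δ

/-! ### Word metrics: from thin triangles to the four-point condition -/

section WordDist

variable {A : Set G}

lemma wordDist_mul_left (g x y : G) : wordDist A (g * x) (g * y) = wordDist A x y := by
  have key : ∀ (g x y : G), ∀ p : (SimpleGraph.mulCayley A).Walk x y,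
      ∃ q : (SimpleGraph.mulCayley A).Walk (g * x) (g * y), q.length = p.length := by
    intro g x y p
    induction p with
    | nil => exact ⟨.nil, rfl⟩
    | cons h p ih =>
      obtain ⟨q, hq⟩ := ih
      exact ⟨.cons (SimpleGraph.mulCayley_adj_mul_iff_right.mpr h) q, by simp [hq]⟩
  unfold wordDist
  rw [SimpleGraph.dist_eq_sInf, SimpleGraph.dist_eq_sInf]
  congr 1
  ext n
  constructor
  · rintro ⟨p, rfl⟩
    obtain ⟨q, hq⟩ := key g⁻¹ _ _ p
    exact ⟨q.copy (by simp) (by simp), by simpa using hq⟩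
  · rintro ⟨p, rfl⟩
    exact key g _ _ p

lemma connected_mulCayley (hA : Subgroup.closure A = ⊤) :
    (SimpleGraph.mulCayley A).Connected := by
  have step : ∀ x a : G, a ∈ A → (SimpleGraph.mulCayley A).Reachable x (x * a) := by
    intro x a ha
    by_cases h : x = x * a
    · rw [← h]
    · exact ((SimpleGraph.mulCayley_adj A _ _).mpr ⟨h, Or.inl (by simpa using ha)⟩).reachable
  have reach : ∀ y : G, (SimpleGraph.mulCayley A).Reachable 1 y := by
    intro y
    have hy : y ∈ Subgroup.closure A := hA ▸ Subgroup.mem_top y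
    induction hy using Subgroup.closure_induction_right with
    | one => rfl
    | mul_right x _ a ha ih => exact ih.trans (step x a ha)
    | mul_inv_cancel x _ a ha ih =>
      exact ih.trans (by simpa using (step (x * a⁻¹) a ha).symm)
  exact { preconnected := fun x y => (reach x).symm.trans (reach y), nonempty := ⟨1⟩ }

lemma finite_wordDist_ball (hfin : A.Finite) (hA : Subgroup.closure A = ⊤) (r : ℕ) :
    {x | wordDist A 1 x ≤ r}.Finite := by
  have hc := connected_mulCayley hA
  induction r with
  | zero =>
    refine (Set.finite_singleton (1 : G)).subset fun x hx => ?_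
    exact (hc.dist_eq_zero_iff.mp (Nat.le_zero.mp hx)).symm
  | succ r ih =>
    refine (ih.union (ih.mul (hfin.union hfin.inv))).subset fun x hx => ?_
    obtain ⟨p, hp⟩ := hc.exists_walk_length_eq_dist x 1
    cases p with
    | nil => exact Or.inl (by simp [wordDist])
    | @cons _ y _ h p =>
      right
      have hy : wordDist A 1 y ≤ r := by
        have h1 : (SimpleGraph.mulCayley A).dist y 1 ≤ p.length := SimpleGraph.dist_le p
        have h2 : wordDist A 1 x ≤ r + 1 := hx
        simp only [SimpleGraph.Walk.length_cons] at hp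
        unfold wordDist at *
        rw [SimpleGraph.dist_comm] at h2 ⊢
        omega
      refine Set.mem_mul.mpr ⟨y, hy, y⁻¹ * x, ?_, by group⟩
      rcases ((SimpleGraph.mulCayley_adj A _ _).mp h).2 with h | h
      · exact Or.inr (by simpa using h)
      · exact Or.inl h

lemma IsGeodesic.dist_getVert {x y : G} {p : (SimpleGraph.mulCayley A).Walk x y}
    (hA : Subgroup.closure A = ⊤) (hp : IsGeodesic p) {n : ℕ} (hn : n ≤ wordDist A x y) :
    wordDist A x (p.getVert n) = n ∧ wordDist A (p.getVert n) y = wordDist A x y - n := by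
  have hc := connected_mulCayley hA
  have h1 := SimpleGraph.dist_le (p.take n)
  have h2 := SimpleGraph.dist_le (p.drop n)
  have h3 := hc.dist_triangle (u := x) (v := p.getVert n) (w := y)
  rw [SimpleGraph.Walk.take_length] at h1
  rw [SimpleGraph.Walk.drop_length] at h2
  unfold IsGeodesic at hp
  unfold wordDist at *
  omega

lemma IsGeodesic.dist_add_dist {x y : G} {p : (SimpleGraph.mulCayley A).Walk x y}
    (hA : Subgroup.closure A = ⊤) (hp : IsGeodesic p) {w : G} (hw : w ∈ p.support) :
    wordDist A x w + wordDist A w y = wordDist A x y := by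
  obtain ⟨n, rfl, hn⟩ := SimpleGraph.Walk.mem_support_iff_exists_getVert.mp hw
  have := hp.dist_getVert hA (n := n) (by rw [← hp]; exact hn)
  have h : p.length = wordDist A x y := hp
  omega

lemma IsWordHyperbolic.exists_hypDist (h : IsWordHyperbolic A) :
    ∃ δ, HypDist (wordDist A) δ := by
  obtain ⟨δ, -, hthin⟩ := h.exists_thin
  have hA := h.closure_eq_top
  have hc := connected_mulCayley hA
  have comm : ∀ x y, wordDist A x y = wordDist A y x := fun x y => SimpleGraph.dist_comm
  have tri : ∀ x y z, wordDist A x z ≤ wordDist A x y + wordDist A y z :=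
    fun x y z => hc.dist_triangle
  have geo : ∀ x y, ∃ p : (SimpleGraph.mulCayley A).Walk x y, IsGeodesic p :=
    fun x y => hc.exists_walk_length_eq_dist x y
  obtain ⟨k, hk⟩ := exists_nat_ge δ
  refine ⟨2 * k + 2, fun x => SimpleGraph.dist_self, comm, tri, wordDist_mul_left,
    finite_wordDist_ball h.finite hA, ?_, ?_⟩
  · intro x y n hn
    obtain ⟨p, hp⟩ := geo x y
    have := hp.dist_getVert hA hn
    exact ⟨p.getVert n, this.1, by omega⟩
  · intro x y z w
    obtain ⟨p, hp⟩ := geo w x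
    obtain ⟨q, hq⟩ := geo w y
    obtain ⟨r, hr⟩ := geo w z
    have thin : ∀ a b : G, ∀ (p : (SimpleGraph.mulCayley A).Walk w a)
        (q : (SimpleGraph.mulCayley A).Walk w b), IsGeodesic p → IsGeodesic q → ∀ n : ℕ,
        2 * n + wordDist A a b ≤ wordDist A w a + wordDist A w b →
        wordDist A (p.getVert n) (q.getVert n) ≤ k := by
      intro a b p q hp hq n hn
      have := hthin w a b p q hp hq n (by
        unfold gromovProduct
        rw [comm a w, comm b w]
        have : (2 * n + wordDist A a b : ℝ) ≤ wordDist A w a + wordDist A w b := by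
          exact_mod_cast hn
        linarith)
      exact_mod_cast this.trans hk
    obtain ⟨n, hn1, hn2, hn3⟩ : ∃ n : ℕ,
        2 * n + wordDist A x y ≤ wordDist A w x + wordDist A w y ∧
        2 * n + wordDist A y z ≤ wordDist A w y + wordDist A w z ∧
        (wordDist A w x + wordDist A w y ≤ 2 * n + 1 + wordDist A x y ∨
          wordDist A w y + wordDist A w z ≤ 2 * n + 1 + wordDist A y z) := by
      have h1 := tri x w y
      have h2 := tri y w z
      rw [comm x w] at h1
      rw [comm y w] at h2
      -- The sides from `w` to `x` and to `z` are both `k`-close to the side to `y` at depth `n`.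
      -- Rounding down loses at most 1, which the constant `2 * k + 2` covers.
      refine ⟨min ((wordDist A w x + wordDist A w y - wordDist A x y) / 2)
        ((wordDist A w y + wordDist A w z - wordDist A y z) / 2), ?_⟩
      omega
    have t1 := thin x y p q hp hq n hn1
    have t2 := thin y z q r hq hr n hn2
    have hnx : n ≤ wordDist A w x := by
      have := tri w x y
      omega
    have hnz : n ≤ wordDist A w z := by
      have := tri w z y
      rw [comm z y] at this
      omega
    have e1 := (hp.dist_getVert hA hnx).2
    have e2 := (hr.dist_getVert hA hnz).2
    have s1 := tri x (p.getVert n) z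
    have s2 := tri (p.getVert n) (q.getVert n) z
    have s3 := tri (q.getVert n) (r.getVert n) z
    rw [comm x (p.getVert n)] at s1
    omega

end WordDist

/-! ### Coarse quasiconvexity -/

/-- The coarse form of quasiconvexity: points that are almost between two points of `Q` are
uniformly close to `Q`. -/
def CoarseQC (d : G → G → ℕ) (Q : Set G) : Prop :=
  ∀ c : ℕ, ∃ r : ℕ, ∀ u ∈ Q, ∀ v ∈ Q, ∀ w, d u w + d w v ≤ d u v + c → ∃ t ∈ Q, d w t ≤ r

/-- By the four-point condition, a point with defect `c` is within `c + δ` of a point exactly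
between `u` and `v`. -/
lemma HypDist.coarseQC_of_between {d : G → G → ℕ} {δ : ℕ} (hd : HypDist d δ) {Q : Set G} {r : ℕ}
    (hr : ∀ u ∈ Q, ∀ v ∈ Q, ∀ w, d u w + d w v = d u v → ∃ t ∈ Q, d w t ≤ r) :
    CoarseQC d Q := by
  intro c
  refine ⟨r + c + δ, fun u hu v hv w hw => ?_⟩
  obtain ⟨w', h1, h2⟩ := hd.exists_between u v (min (d u w) (d u v)) (by omega)
  obtain ⟨t, ht, htr⟩ := hr u hu v hv w' h2
  refine ⟨t, ht, ?_⟩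
  have := hd.four_point u w v w'
  have := hd.tri w w' t
  have := hd.comm w w'
  have := hd.comm u w'
  omega

lemma IsQuasiconvex.coarseQC {A : Set G} {δ : ℕ} (hA : Subgroup.closure A = ⊤)
    (hd : HypDist (wordDist A) δ) {Q : Set G} (hQ : IsQuasiconvex A Q) :
    CoarseQC (wordDist A) Q := by
  obtain ⟨ε, -, hε⟩ := hQ
  obtain ⟨r, hr⟩ := exists_nat_ge ε
  refine hd.coarseQC_of_between (r := r) fun u hu v hv w hw => ?_
  have hc := connected_mulCayley hA
  obtain ⟨p, hp⟩ := hc.exists_walk_length_eq_dist u w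
  obtain ⟨q, hq⟩ := hc.exists_walk_length_eq_dist w v
  obtain ⟨t, ht, h⟩ := hε u hu v hv (p.append q)
    (by rw [IsGeodesic, SimpleGraph.Walk.length_append, hp, hq]; exact hw) w
    (by simp)
  exact ⟨t, ht, by exact_mod_cast h.trans hr⟩

lemma CoarseQC.isQuasiconvex {A : Set G} (hA : Subgroup.closure A = ⊤) {Q : Set G}
    (hQ : CoarseQC (wordDist A) Q) : IsQuasiconvex A Q := by
  obtain ⟨r, hr⟩ := hQ 0
  refine ⟨r, by positivity, fun u hu v hv p hp w hw => ?_⟩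
  obtain ⟨t, ht, h⟩ := hr u hu v hv w (hp.dist_add_dist hA hw).le
  exact ⟨t, ht, by exact_mod_cast h⟩

/-! ### Intersections, conjugates and corners of quasiconvex subgroups -/

section Geometry

variable {d : G → G → ℕ} {δ : ℕ}

lemma HypDist.inv_mul (hd : HypDist d δ) (g x y : G) : d (g⁻¹ * x) y = d x (g * y) := by
  rw [← hd.mul_left g, mul_inv_cancel_left]

lemma HypDist.mul_self_right (hd : HypDist d δ) (x g : G) : d x (x * g) = d 1 g := by
  simpa using hd.mul_left x 1 g

/-- The pair `p = (w⁻¹ a, w⁻¹ b)` takes finitely many values. With one solution `f p` fixed for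
each, `w (f p)⁻¹` lies in both subgroups, at a distance from `w` that depends only on `p`. -/
lemma HypDist.exists_near_inf (hd : HypDist d δ) (H K : Subgroup G) (r : ℕ) :
    ∃ M, ∀ w, (∃ a ∈ H, d w a ≤ r) → (∃ b ∈ K, d w b ≤ r) → ∃ t ∈ H ⊓ K, d w t ≤ M := by
  classical
  let f : G × G → G := fun p => if h : ∃ w, w * p.1 ∈ H ∧ w * p.2 ∈ K then h.choose else 1
  have hf : ∀ p : G × G, (∃ w, w * p.1 ∈ H ∧ w * p.2 ∈ K) → f p * p.1 ∈ H ∧ f p * p.2 ∈ K := by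
    intro p h
    simp only [f, dif_pos h]
    exact h.choose_spec
  have hfin := ((hd.finite_ball r).prod (hd.finite_ball r)).image fun p => d (f p) 1
  obtain ⟨M, hM⟩ := hfin.bddAbove
  refine ⟨M, ?_⟩
  rintro w ⟨a, ha, hwa⟩ ⟨b, hb, hwb⟩
  have hw : w * (w⁻¹ * a, w⁻¹ * b).1 ∈ H ∧ w * (w⁻¹ * a, w⁻¹ * b).2 ∈ K := by simp [ha, hb]
  have hp := hf (w⁻¹ * a, w⁻¹ * b) ⟨w, hw⟩
  have hball : (w⁻¹ * a, w⁻¹ * b) ∈ {x | d 1 x ≤ r} ×ˢ {x | d 1 x ≤ r} := by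
    refine ⟨?_, ?_⟩
    · simpa [← hd.mul_self_right w] using hwa
    · simpa [← hd.mul_self_right w] using hwb
  have hle := hM (Set.mem_image_of_mem _ hball)
  generalize (w⁻¹ * a, w⁻¹ * b) = p at *
  refine ⟨w * (f p)⁻¹, ⟨?_, ?_⟩, ?_⟩
  · have := H.mul_mem hw.1 (H.inv_mem hp.1)
    simpa [mul_assoc] using this
  · have := K.mul_mem hw.2 (K.inv_mem hp.2)
    simpa [mul_assoc] using this
  · rw [hd.mul_self_right]
    have : d 1 (f p)⁻¹ = d (f p) 1 := by rw [← hd.mul_left (f p)]; simp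
    rw [this]
    exact hle

lemma HypDist.exists_near_of_finiteIndex (hd : HypDist d δ) (N : Subgroup G) [N.FiniteIndex] :
    ∃ M, ∀ w, ∃ t ∈ N, d w t ≤ M := by
  obtain ⟨M, hM⟩ := (Set.finite_range fun c : G ⧸ N => d 1 c.out).bddAbove
  refine ⟨M, fun w => ?_⟩
  have h : ((w⁻¹ : G) : G ⧸ N) = ((((w⁻¹ : G) : G ⧸ N).out : G) : G ⧸ N) := by simp
  refine ⟨w * ((w⁻¹ : G) : G ⧸ N).out, ?_, ?_⟩
  · simpa using QuotientGroup.eq.mp h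
  · rw [hd.mul_self_right]
    exact hM ⟨_, rfl⟩

lemma CoarseQC.inf (hd : HypDist d δ) {H K : Subgroup G} (hH : CoarseQC d (H : Set G))
    (hK : CoarseQC d (K : Set G)) : CoarseQC d ((H ⊓ K : Subgroup G) : Set G) := by
  intro c
  obtain ⟨r₁, h₁⟩ := hH c
  obtain ⟨r₂, h₂⟩ := hK c
  obtain ⟨M, hM⟩ := hd.exists_near_inf H K (max r₁ r₂)
  refine ⟨M, fun u hu v hv w hw => hM w ?_ ?_⟩
  · obtain ⟨t, ht, h⟩ := h₁ u hu.1 v hv.1 w hw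
    exact ⟨t, ht, h.trans (le_max_left _ _)⟩
  · obtain ⟨t, ht, h⟩ := h₂ u hu.2 v hv.2 w hw
    exact ⟨t, ht, h.trans (le_max_right _ _)⟩

lemma coarseQC_of_finiteIndex (hd : HypDist d δ) (N : Subgroup G) [N.FiniteIndex] :
    CoarseQC d (N : Set G) := by
  obtain ⟨M, hM⟩ := hd.exists_near_of_finiteIndex N
  exact fun _ => ⟨M, fun _ _ _ _ w _ => hM w⟩

lemma mem_map_conj {H : Subgroup G} {g x : G} :
    x ∈ H.map (MulAut.conj g).toMonoidHom ↔ g⁻¹ * x * g ∈ H := by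
  constructor
  · rintro ⟨y, hy, rfl⟩
    simpa [mul_assoc] using hy
  · intro h
    exact ⟨_, h, by simp [mul_assoc]⟩

lemma CoarseQC.map_conj (hd : HypDist d δ) {H : Subgroup G} (hH : CoarseQC d (H : Set G)) (g : G) :
    CoarseQC d (H.map (MulAut.conj g).toMonoidHom : Set G) := by
  intro c
  -- Right multiplication by `g` moves `u` and `v` by `d 1 g` each, which affects both sides of the
  -- inequality.
  obtain ⟨r, hr⟩ := hH (c + 4 * d 1 g)
  refine ⟨r + d 1 g⁻¹, fun u hu v hv w hw => ?_⟩
  obtain ⟨t, ht, h⟩ := hr _ (mem_map_conj.mp hu) _ (mem_map_conj.mp hv) (g⁻¹ * w) (by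
    simp only [mul_assoc, hd.mul_left]
    have h1 := hd.mul_self_right u g
    have h2 := hd.mul_self_right v g
    have := hd.tri (u * g) u w
    have := hd.tri w v (v * g)
    have := hd.tri u (u * g) v
    have := hd.tri (u * g) (v * g) v
    have := hd.comm (u * g) u
    have := hd.comm (v * g) v
    omega)
  refine ⟨g * t * g⁻¹, mem_map_conj.mpr (by simpa [mul_assoc] using ht), ?_⟩
  have h1 := hd.tri w (g * t) (g * t * g⁻¹)
  rw [hd.mul_self_right] at h1
  rw [hd.inv_mul] at h
  omega

lemma HypDist.coarseQC_bot (hd : HypDist d δ) : CoarseQC d ((⊥ : Subgroup G) : Set G) := by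
  refine fun c => ⟨c, fun u hu v hv w hw => ⟨u, hu, ?_⟩⟩
  obtain rfl : u = 1 := hu
  obtain rfl : v = 1 := hv
  have := hd.self 1
  have := hd.comm w 1
  omega

/-- A vertex of a path whose adjacent edges lie in `H` and `K`, and which cannot be moved inside
its `H ⊓ K`-coset so as to shorten the path, has a bounded Gromov product. -/
lemma HypDist.exists_backtrack_bound (hd : HypDist d δ) {H K : Subgroup G}
    (hH : CoarseQC d (H : Set G)) (hK : CoarseQC d (K : Set G)) :
    ∃ c, ∀ p v q, v⁻¹ * p ∈ H → v⁻¹ * q ∈ K →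
      (∀ t ∈ H ⊓ K, d p v + d v q ≤ d p (v * t) + d (v * t) q) →
      d p v + d v q ≤ d p q + c := by
  obtain ⟨r₁, h₁⟩ := hH δ
  obtain ⟨r₂, h₂⟩ := hK 0
  obtain ⟨M, hM⟩ := hd.exists_near_inf H K (max r₁ r₂)
  refine ⟨2 * M + δ + 1, fun p v q hp hq hmin => ?_⟩
  -- At the depth of the rounded Gromov product, `w` on `[v, q]` is also almost between `v` and `p`,
  -- so `v⁻¹ w` is close to `H ⊓ K`. If the depth were large, moving `v` there would shorten the
  -- path.
  obtain ⟨w, hw1, hw2⟩ := hd.exists_between v q ((d p v + d v q - d p q) / 2) (by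
    have := hd.tri p q v
    have := hd.comm q v
    omega)
  have hwp : d w p + (d p v + d v q - d p q) / 2 ≤ d v p + δ := by
    have := hd.four_point v p q w
    have := hd.four_point v w p q
    have := hd.tri p v q
    have := hd.comm p v
    have := hd.comm w v
    have := hd.comm w p
    have := hd.comm w q
    have := hd.comm p q
    have := hd.comm v q
    omega
  obtain ⟨t, ht, htM⟩ := hM (v⁻¹ * w)
    (by
      obtain ⟨a, ha, h⟩ := h₁ 1 H.one_mem _ hp (v⁻¹ * w) (by
        have h1 := hd.mul_left v⁻¹ v w
        have h2 := hd.mul_left v⁻¹ v p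
        rw [inv_mul_cancel] at h1 h2
        rw [hd.mul_left, h1, h2]
        omega)
      exact ⟨a, ha, h.trans (le_max_left _ _)⟩)
    (by
      obtain ⟨a, ha, h⟩ := h₂ 1 K.one_mem _ hq (v⁻¹ * w) (by
        have h1 := hd.mul_left v⁻¹ v w
        have h2 := hd.mul_left v⁻¹ v q
        rw [inv_mul_cancel] at h1 h2
        rw [hd.mul_left, h1, h2]
        omega)
      exact ⟨a, ha, h.trans (le_max_right _ _)⟩)
  rw [hd.inv_mul] at htM
  have := hmin t ht
  have := hd.tri p w (v * t)
  have := hd.tri (v * t) w q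
  have := hd.comm p w
  have := hd.comm p v
  have := hd.comm w (v * t)
  omega

/-! ### Broken geodesics: from local to global -/

/-- A broken geodesic whose Gromov products at the break points are bounded and whose edges, up to
the first and the last, are long. -/
structure IsBroken (d : G → G → ℕ) (δ c m : ℕ) (x : ℕ → G) : Prop where
  corner : ∀ k, k + 2 ≤ m →
    d (x k) (x (k + 1)) + d (x (k + 1)) (x (k + 2)) ≤ d (x k) (x (k + 2)) + c
  long : ∀ k, 1 ≤ k → k + 2 ≤ m → 2 * c + 3 * δ < 2 * d (x k) (x (k + 1))

/-- The edge into a corner is long and the Gromov product at its start is small, so at the corner `x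
0` and the preceding vertex have a large product. The four-point condition then carries the corner
bound over to `x 0`, and the error `δ` does not accumulate. -/
lemma IsBroken.left (hd : HypDist d δ) {c m : ℕ} {x : ℕ → G} (h : IsBroken d δ c m x) (k : ℕ)
    (hk : k + 2 ≤ m) :
    d (x 0) (x (k + 1)) + d (x (k + 1)) (x (k + 2)) ≤ d (x 0) (x (k + 2)) + c + δ := by
  induction k with
  | zero => have := h.corner 0 hk; simp only [zero_add] at *; omega
  | succ k ih =>
    have := ih (by omega)
    have := h.corner (k + 1) (by omega)
    have := h.long (k + 1) (by omega) (by omega)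
    have := hd.four_point (x 0) (x (k + 3)) (x (k + 2)) (x (k + 1))
    have := hd.four_point (x 0) (x (k + 1)) (x (k + 2)) (x (k + 3))
    have := hd.comm (x (k + 1)) (x 0)
    have := hd.comm (x (k + 3)) (x 0)
    have := hd.comm (x (k + 3)) (x (k + 1))
    have := hd.comm (x (k + 3)) (x (k + 2))
    simp only [add_assoc, Nat.reduceAdd] at *
    omega

lemma IsBroken.reverse (hd : HypDist d δ) {c m : ℕ} {x : ℕ → G} (h : IsBroken d δ c m x) :
    IsBroken d δ c m fun i => x (m - i) := by
  constructor
  · intro k hk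
    obtain ⟨j, rfl⟩ := Nat.exists_eq_add_of_le' hk
    have := h.corner j (by omega)
    rw [show j + (k + 2) - k = j + 2 by omega, show j + (k + 2) - (k + 1) = j + 1 by omega,
      show j + (k + 2) - (k + 2) = j by omega]
    have := hd.comm (x (j + 2)) (x (j + 1))
    have := hd.comm (x (j + 1)) (x j)
    have := hd.comm (x (j + 2)) (x j)
    omega
  · intro k hk1 hk
    obtain ⟨j, rfl⟩ := Nat.exists_eq_add_of_le' hk
    have := h.long (j + 1) (by omega) (by omega)
    rw [show j + (k + 2) - k = j + 2 by omega, show j + (k + 2) - (k + 1) = j + 1 by omega,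
      hd.comm]
    exact this

lemma IsBroken.right (hd : HypDist d δ) {c m : ℕ} {x : ℕ → G} (h : IsBroken d δ c m x) (k : ℕ)
    (hk : k + 2 ≤ m) :
    d (x k) (x (k + 1)) + d (x (k + 1)) (x m) ≤ d (x k) (x m) + c + δ := by
  obtain ⟨j, rfl⟩ := Nat.exists_eq_add_of_le' hk
  have := (h.reverse hd).left hd j (by omega)
  rw [show j + (k + 2) - (j + 1) = k + 1 by omega, show j + (k + 2) - (j + 2) = k by omega,
    Nat.sub_zero, hd.comm _ (x (k + 1)), hd.comm _ (x k), hd.comm _ (x k)] at this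
  omega

/-- At an inner vertex, the bounds from the left and from the right are combined across the long
edge that leaves it. This step needs the full length `2 * c + 3 * δ`. -/
lemma IsBroken.between (hd : HypDist d δ) {c m : ℕ} {x : ℕ → G} (h : IsBroken d δ c m x) {k : ℕ}
    (hk : k ≤ m) : d (x 0) (x k) + d (x k) (x m) ≤ d (x 0) (x m) + c + 2 * δ := by
  rcases Nat.eq_zero_or_pos k with rfl | h0
  · have := hd.self (x 0)
    omega
  obtain ⟨k, rfl⟩ := Nat.exists_eq_add_of_lt h0
  rw [zero_add] at *
  rcases hk.eq_or_lt with rfl | hk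
  · have := hd.self (x (k + 1))
    omega
  have hl := h.left hd k hk
  rcases Nat.eq_or_lt_of_le hk with he | hk
  · rw [← he]
    simp only [Nat.succ_eq_add_one, add_assoc, Nat.reduceAdd] at *
    omega
  have hr := h.right hd (k + 1) hk
  have := h.long (k + 1) (by omega) hk
  have := hd.four_point (x 0) (x m) (x (k + 2)) (x (k + 1))
  have := hd.four_point (x 0) (x (k + 1)) (x (k + 2)) (x m)
  have := hd.comm (x (k + 1)) (x 0)
  have := hd.comm (x m) (x 0)
  have := hd.comm (x m) (x (k + 1))
  have := hd.comm (x m) (x (k + 2))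
  simp only [add_assoc, Nat.reduceAdd] at *
  omega

lemma IsBroken.exists_near_edge (hd : HypDist d δ) {c m : ℕ} {x : ℕ → G} (h : IsBroken d δ c m x)
    (hm : 0 < m) {w : G} (hw : d (x 0) w + d w (x m) = d (x 0) (x m)) :
    ∃ k < m, d (x k) w + d w (x (k + 1)) ≤ d (x k) (x (k + 1)) + (c + 6 * δ) := by
  by_cases hlast : d (x m) w + d w (x m) ≤ d (x m) (x m) + δ
  · obtain ⟨k, rfl⟩ := Nat.exists_eq_add_of_lt hm
    rw [zero_add] at *
    refine ⟨k, by omega, ?_⟩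
    have := hd.tri (x k) (x (k + 1)) w
    have := hd.self (x (k + 1))
    omega
  -- An edge across which `w` ceases to be almost between the vertex and `x m`; the four-point
  -- condition places `w` along it.
  obtain ⟨k, hk, hP, hP'⟩ : ∃ k < m, d (x k) w + d w (x m) ≤ d (x k) (x m) + δ ∧
      ¬ d (x (k + 1)) w + d w (x m) ≤ d (x (k + 1)) (x m) + δ := by
    by_contra! hcon
    refine hlast ?_
    have key : ∀ k ≤ m, d (x k) w + d w (x m) ≤ d (x k) (x m) + δ := by
      intro k
      induction k with
      | zero => intro _; omega
      | succ k ih => exact fun hk => hcon k hk (ih (by omega))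
    exact key m le_rfl
  refine ⟨k, hk, ?_⟩
  have := h.between hd (k := k) (by omega)
  have := hd.four_point (x 0) (x (k + 1)) (x m) w
  have := hd.four_point (x 0) (x k) (x (k + 1)) w
  have := hd.comm w (x 0)
  have := hd.comm w (x k)
  have := hd.comm w (x (k + 1))
  have := hd.tri w (x k) (x (k + 1))
  omega

end Geometry

/-! ### Products of subgroups and polygons labelled by them -/

/-- The product `G₁ G₂ ⋯ Gₛ` of a list of subgroups. -/
def subgroupProd (l : List (Subgroup G)) : Set G :=
  (l.map fun H : Subgroup G => (H : Set G)).prod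

@[simp] lemma subgroupProd_nil : subgroupProd ([] : List (Subgroup G)) = {1} := rfl

@[simp] lemma subgroupProd_cons (H : Subgroup G) (l : List (Subgroup G)) :
    subgroupProd (H :: l) = (H : Set G) * subgroupProd l := by
  simp [subgroupProd]

lemma subgroupProd_append (l l' : List (Subgroup G)) :
    subgroupProd (l ++ l') = subgroupProd l * subgroupProd l' := by
  simp [subgroupProd]

section Polygon

variable {d : G → G → ℕ} {δ : ℕ}

lemma HypDist.inv_right (hd : HypDist d δ) (u : G) : d 1 u⁻¹ = d 1 u := by
  rw [hd.comm 1 u⁻¹, ← hd.mul_left u]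
  simp

/-- Let `y, y g₁, y g₁ g₂, …, g` be a broken line whose edges are labelled by elements of the
subgroups of a list. A point almost between `y` and `g` is close to one of the cosets that contain
the sides, which splits the list in two. -/
lemma HypDist.exists_near_side (hd : HypDist d δ) (l : List (Subgroup G))
    (hl : ∀ H ∈ l, CoarseQC d (H : Set G)) (c : ℕ) :
    ∃ R, ∀ y v g, y⁻¹ * g ∈ subgroupProd l → d y v + d v g ≤ d y g + c →
      ∃ (pre suf : List (Subgroup G)) (u : G), pre.Sublist l ∧ suf.Sublist l ∧
        subgroupProd pre * subgroupProd suf ⊆ subgroupProd l ∧ d 1 u ≤ R ∧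
        y⁻¹ * v * u⁻¹ ∈ subgroupProd pre ∧ u * v⁻¹ * g ∈ subgroupProd suf := by
  induction l generalizing c with
  | nil =>
    refine ⟨c, fun y v g hg h => ⟨[], [], g⁻¹ * v, .refl _, .refl _, by simp, ?_, ?_, by simp⟩⟩
    · obtain rfl : y = g := by simpa [inv_mul_eq_one] using hg
      have h1 := hd.mul_left y⁻¹ y v
      rw [inv_mul_cancel] at h1
      have := hd.self y
      omega
    · obtain rfl : y = g := by simpa [inv_mul_eq_one] using hg
      simp
  | cons H l ih =>
    obtain ⟨R, hR⟩ := ih (fun K hK => hl K (List.mem_cons_of_mem _ hK)) (c + δ)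
    obtain ⟨r, hr⟩ := hl H List.mem_cons_self (c + δ)
    refine ⟨max R r, fun y v g hg h => ?_⟩
    rw [subgroupProd_cons] at hg
    obtain ⟨a, ha, q, hq, haq⟩ := Set.mem_mul.mp hg
    have hq' : (y * a)⁻¹ * g = q := by rw [mul_inv_rev, mul_assoc, ← haq]; simp
    have hor : d (y * a) v + d v g ≤ d (y * a) g + (c + δ) ∨
        d y v + d v (y * a) ≤ d y (y * a) + (c + δ) := by
      have := hd.four_point y g v (y * a)
      have := hd.four_point y v g (y * a)
      have := hd.comm v (y * a)
      have := hd.comm y (y * a)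
      have := hd.comm v g
      omega
    rcases hor with h' | h'
    · obtain ⟨pre, suf, u, hpre, hsuf, hsub, hu, h1, h2⟩ := hR (y * a) v g (by rwa [hq']) h'
      refine ⟨H :: pre, suf, u, hpre.cons_cons H, hsuf.cons H, ?_, hu.trans (le_max_left _ _), ?_,
        h2⟩
      · simp only [subgroupProd_cons, mul_assoc]
        exact Set.mul_subset_mul_left hsub
      · rw [subgroupProd_cons]
        exact Set.mem_mul.mpr ⟨a, ha, _, h1, by group⟩
    · obtain ⟨t, ht, htr⟩ := hr 1 H.one_mem a ha (y⁻¹ * v) (by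
        have h1 := hd.mul_left y 1 (y⁻¹ * v)
        have h2 := hd.mul_left y (y⁻¹ * v) a
        have h3 := hd.mul_left y 1 a
        rw [mul_one, mul_inv_cancel_left] at h1
        rw [mul_inv_cancel_left] at h2
        rw [mul_one] at h3
        omega)
      -- The point cuts the side labelled `a` in two, so `H` occurs in both parts; this is harmless
      -- as `H * H = H`.
      refine ⟨[H], H :: l, t⁻¹ * (y⁻¹ * v), List.singleton_sublist.mpr List.mem_cons_self, .refl _,
        ?_, ?_, ?_, ?_⟩
      · simp only [subgroupProd_cons, subgroupProd_nil, Set.singleton_one, mul_one, ← mul_assoc]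
        rw [coe_mul_coe]
      · refine le_trans ?_ (le_max_right _ _)
        rw [← hd.mul_left t, mul_one, mul_inv_cancel_left, hd.comm]
        exact htr
      · simpa [mul_assoc] using ht
      · rw [subgroupProd_cons]
        refine Set.mem_mul.mpr ⟨t⁻¹ * a, H.mul_mem (H.inv_mem ht) ha, q, hq, ?_⟩
        rw [mul_assoc, haq]
        group

lemma finite_sublists {α : Type*} (l : List α) : {l' : List α | l'.Sublist l}.Finite :=
  (List.finite_toSet l.sublists).subset fun _ h => List.mem_sublists.mpr h

/-- A first split leaves a list that depends on the point. Sublists being finite in number, one `R`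
serves for splitting them all again. -/
lemma HypDist.exists_near_side_of_sublist (hd : HypDist d δ) (l : List (Subgroup G))
    (hl : ∀ H ∈ l, CoarseQC d (H : Set G)) (c : ℕ) :
    ∃ R, ∀ l' : List (Subgroup G), l'.Sublist l → ∀ y v g, y⁻¹ * g ∈ subgroupProd l' →
      d y v + d v g ≤ d y g + c →
      ∃ (pre suf : List (Subgroup G)) (u : G), pre.Sublist l' ∧ suf.Sublist l' ∧
        subgroupProd pre * subgroupProd suf ⊆ subgroupProd l' ∧ d 1 u ≤ R ∧
        y⁻¹ * v * u⁻¹ ∈ subgroupProd pre ∧ u * v⁻¹ * g ∈ subgroupProd suf := by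
  have h : ∀ l' : List (Subgroup G), ∃ R, l'.Sublist l → ∀ y v g, y⁻¹ * g ∈ subgroupProd l' →
      d y v + d v g ≤ d y g + c →
      ∃ (pre suf : List (Subgroup G)) (u : G), pre.Sublist l' ∧ suf.Sublist l' ∧
        subgroupProd pre * subgroupProd suf ⊆ subgroupProd l' ∧ d 1 u ≤ R ∧
        y⁻¹ * v * u⁻¹ ∈ subgroupProd pre ∧ u * v⁻¹ * g ∈ subgroupProd suf := by
    intro l'
    by_cases hs : l'.Sublist l
    · obtain ⟨R, hR⟩ := hd.exists_near_side l' (fun H hH => hl H (hs.subset hH)) c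
      exact ⟨R, fun _ => hR⟩
    · exact ⟨0, fun h => absurd h hs⟩
  choose R hR using h
  obtain ⟨M, hM⟩ := ((finite_sublists l).image R).bddAbove
  refine ⟨M, fun l' hs y v g hg hv => ?_⟩
  obtain ⟨pre, suf, u, h1, h2, h3, h4, h5⟩ := hR l' hs y v g hg hv
  exact ⟨pre, suf, u, h1, h2, h3, h4.trans (hM (Set.mem_image_of_mem _ hs)), h5⟩

lemma HypDist.exists_two_near_sides (hd : HypDist d δ) (l : List (Subgroup G))
    (hl : ∀ H ∈ l, CoarseQC d (H : Set G)) (c : ℕ) :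
    ∃ R, ∀ y v w g, y⁻¹ * g ∈ subgroupProd l → d y v + d v g ≤ d y g + c →
      d v w + d w g ≤ d v g + c →
      ∃ (pre mid suf : List (Subgroup G)) (a b : G), mid.Sublist l ∧
        subgroupProd pre * (subgroupProd mid * subgroupProd suf) ⊆ subgroupProd l ∧
        d 1 a ≤ R ∧ d 1 b ≤ R ∧ y⁻¹ * v * a⁻¹ ∈ subgroupProd pre ∧
        a * v⁻¹ * w * b⁻¹ ∈ subgroupProd mid ∧ b * w⁻¹ * g ∈ subgroupProd suf := by
  obtain ⟨R₁, h₁⟩ := hd.exists_near_side_of_sublist l hl c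
  -- The second split starts at `v * a⁻¹` instead of `v`, which costs at most `2 * R₁`.
  obtain ⟨R₂, h₂⟩ := hd.exists_near_side_of_sublist l hl (c + 2 * R₁)
  refine ⟨max R₁ R₂, fun y v w g hg hv hw => ?_⟩
  obtain ⟨pre, suf, a, -, hs, hsub, ha, hp, hq⟩ := h₁ l (.refl l) y v g hg hv
  obtain ⟨mid, suf', b, hm, -, hsub', hb, hp', hq'⟩ := h₂ suf hs (v * a⁻¹) w g
    (by simpa using hq) (by
      have h1 := hd.mul_self_right v a⁻¹
      rw [hd.inv_right] at h1
      have := hd.tri (v * a⁻¹) v w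
      have := hd.tri v (v * a⁻¹) g
      have := hd.comm v (v * a⁻¹)
      omega)
  refine ⟨pre, mid, suf', a, b, hm.trans hs, ?_, ha.trans (le_max_left _ _),
    hb.trans (le_max_right _ _), hp, by simpa using hp', hq'⟩
  exact (Set.mul_subset_mul_left hsub').trans hsub

end Polygon

/-! ### Alternating words in two subgroups -/

section Alternating

/-- The `i`-th of the alternating sequence `H, K, H, K, …`. -/
def side (H K : Subgroup G) (i : ℕ) : Subgroup G := if Even i then H else K

variable {H K N : Subgroup G} {T : Set G}

lemma side_two_mul (n : ℕ) : side H K (2 * n) = H := by simp [side]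

lemma side_two_mul_add_one (n : ℕ) : side H K (2 * n + 1) = K := by
  simp [side]

lemma side_add_two (i : ℕ) : side H K (i + 2) = side H K i := by
  simp [side, Nat.even_add]

lemma inf_le_side (i : ℕ) : H ⊓ K ≤ side H K i := by
  unfold side
  split_ifs
  exacts [inf_le_left, inf_le_right]

/-- The partial products of a word `h₀ k₀ h₁ k₁ ⋯ hₙ kₙ`, with value in `T`, whose letters up to the
first and the last lie in `N`. -/
structure IsAlternating (H K N : Subgroup G) (T : Set G) (n : ℕ) (x : ℕ → G) : Prop where
  zero : x 0 = 1
  last : x (2 * n + 2) ∈ T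
  edge : ∀ i ≤ 2 * n + 1, (x i)⁻¹ * x (i + 1) ∈ side H K i
  inner : ∀ i, 1 ≤ i → i ≤ 2 * n → (x i)⁻¹ * x (i + 1) ∈ N

/-- Trivial letters make a word in the generators of the join alternate; `h` and `k`, which need not
lie in `N`, become or join its outer letters. -/
lemma exists_isAlternating {h k z : G} (hh : h ∈ H) (hk : k ∈ K)
    (hz : z ∈ (H ⊓ N) ⊔ (K ⊓ N)) (hT : h * z * k ∈ T) : ∃ n x, IsAlternating H K N T n x := by
  let P : G → Prop := fun z => ∃ (n : ℕ) (x : ℕ → G), x 0 = 1 ∧ x (2 * n + 1) = h * z ∧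
    (∀ i ≤ 2 * n, (x i)⁻¹ * x (i + 1) ∈ side H K i) ∧
    ∀ i, 1 ≤ i → i ≤ 2 * n → (x i)⁻¹ * x (i + 1) ∈ N
  have step : ∀ z a b, a ∈ K ⊓ N → b ∈ H ⊓ N → P z → P (z * a * b) := by
    rintro z a b ha hb ⟨n, x, h0, hlast, hside, hN⟩
    let x' : ℕ → G := fun i =>
      if i ≤ 2 * n + 1 then x i else if i = 2 * n + 2 then h * z * a else h * z * a * b
    have e : ∀ i ≤ 2 * n, (x' i)⁻¹ * x' (i + 1) = (x i)⁻¹ * x (i + 1) := by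
      intro i hi
      simp only [x', if_pos (show i ≤ 2 * n + 1 by omega), if_pos (show i + 1 ≤ 2 * n + 1 by omega)]
    have e1 : (x' (2 * n + 1))⁻¹ * x' (2 * n + 1 + 1) = a := by
      simp [x', hlast, mul_assoc]
    have e2 : (x' (2 * n + 2))⁻¹ * x' (2 * n + 2 + 1) = b := by
      simp [x', mul_assoc]
    refine ⟨n + 1, x', by simp [x', h0], by simp [x', mul_add, mul_assoc], ?_, ?_⟩
    · intro i hi
      obtain hi | rfl | rfl : i ≤ 2 * n ∨ i = 2 * n + 1 ∨ i = 2 * n + 2 := by omega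
      · rw [e i hi]; exact hside i hi
      · rw [e1, side_two_mul_add_one]; exact ha.1
      · rw [e2, side_add_two, side_two_mul]; exact hb.1
    · intro i h1 hi
      obtain hi | rfl | rfl : i ≤ 2 * n ∨ i = 2 * n + 1 ∨ i = 2 * n + 2 := by omega
      · rw [e i hi]; exact hN i h1 hi
      · rw [e1]; exact ha.2
      · rw [e2]; exact hb.2
  have hP1 : P 1 := by
    refine ⟨0, fun i => if i = 0 then 1 else h, by simp, by simp, ?_, by omega⟩
    intro i hi
    obtain rfl : i = 0 := by omega
    simpa [side] using hh
  have step' : ∀ z y, y ∈ ((H ⊓ N : Subgroup G) : Set G) ∪ (K ⊓ N : Subgroup G) → P z →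
      P (z * y) ∧ P (z * y⁻¹) := by
    rintro z y (hy | hy) hz
    · have h1 := step z 1 y (one_mem _) hy hz
      have h2 := step z 1 y⁻¹ (one_mem _) (inv_mem hy) hz
      rw [mul_one] at h1 h2
      exact ⟨h1, h2⟩
    · have h1 := step z y 1 hy (one_mem _) hz
      have h2 := step z y⁻¹ 1 (inv_mem hy) (one_mem _) hz
      rw [mul_one] at h1 h2
      exact ⟨h1, h2⟩
  rw [Subgroup.sup_eq_closure] at hz
  have hPz : P z := Subgroup.closure_induction_right (p := fun z _ => P z) hP1
    (fun x _ y hy ih => (step' x y hy ih).1) (fun x _ y hy ih => (step' x y hy ih).2) hz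
  obtain ⟨n, x, h0, hlast, hside, hN⟩ := hPz
  let x' : ℕ → G := fun i => if i ≤ 2 * n + 1 then x i else h * z * k
  have e : ∀ i ≤ 2 * n, (x' i)⁻¹ * x' (i + 1) = (x i)⁻¹ * x (i + 1) := by
    intro i hi
    simp only [x', if_pos (show i ≤ 2 * n + 1 by omega), if_pos (show i + 1 ≤ 2 * n + 1 by omega)]
  refine ⟨n, x', by simp [x', h0], by simpa [x'] using hT, ?_, ?_⟩
  · intro i hi
    rcases Nat.le_add_one_iff.mp hi with hi | rfl
    · rw [e i hi]; exact hside i hi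
    · rw [side_two_mul_add_one]
      simpa [x', hlast, mul_assoc] using hk
  · intro i h1 hi
    rw [e i hi]; exact hN i h1 hi

/-- The neighbours of the letter `j` lie on the same side, which contains that letter too, so the
three merge into one. -/
lemma IsAlternating.exists_shorter {n : ℕ} {x : ℕ → G} (h : IsAlternating H K N T n x) {j : ℕ}
    (h1 : 1 ≤ j) (hj : j ≤ 2 * n) (hD : (x j)⁻¹ * x (j + 1) ∈ H ⊓ K) :
    ∃ m < n, ∃ x', IsAlternating H K N T m x' := by
  obtain ⟨n, rfl⟩ : ∃ m, n = m + 1 := ⟨n - 1, by omega⟩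
  obtain ⟨j, rfl⟩ : ∃ i, j = i + 1 := ⟨j - 1, by omega⟩
  let x' : ℕ → G := fun i => if i ≤ j then x i else x (i + 2)
  have e1 : ∀ i < j, (x' i)⁻¹ * x' (i + 1) = (x i)⁻¹ * x (i + 1) := by
    intro i hi
    simp only [x', if_pos hi.le, if_pos (show i + 1 ≤ j by omega)]
  have e2 : (x' j)⁻¹ * x' (j + 1) = (x j)⁻¹ * x (j + 1) * ((x (j + 1))⁻¹ * x (j + 1 + 1)) *
      ((x (j + 2))⁻¹ * x (j + 2 + 1)) := by
    simp only [x', if_pos le_rfl, if_neg (show ¬ j + 1 ≤ j by omega)]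
    simp [mul_assoc]
  have e3 : ∀ i, j < i → (x' i)⁻¹ * x' (i + 1) = (x (i + 2))⁻¹ * x (i + 2 + 1) := by
    intro i hi
    simp only [x', if_neg (show ¬ i ≤ j by omega), if_neg (show ¬ i + 1 ≤ j by omega)]
  refine ⟨n, n.lt_succ_self, x', by simp [x', h.zero], ?_, ?_, ?_⟩
  · have := h.last
    simp only [x', if_neg (show ¬ 2 * n + 2 ≤ j by omega)]
    exact this
  · intro i hi
    obtain hij | rfl | hij := lt_trichotomy i j
    · rw [e1 i hij]; exact h.edge i (by omega)
    · rw [e2]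
      refine mul_mem (mul_mem (h.edge i (by omega)) (inf_le_side i hD)) ?_
      rw [← side_add_two]
      exact h.edge (i + 2) (by omega)
    · rw [e3 i hij, ← side_add_two]; exact h.edge (i + 2) (by omega)
  · intro i hi1 hi
    obtain hij | rfl | hij := lt_trichotomy i j
    · rw [e1 i hij]; exact h.inner i hi1 (by omega)
    · rw [e2]
      exact mul_mem (mul_mem (h.inner i hi1 (by omega)) (h.inner (i + 1) (by omega) (by omega)))
        (h.inner (i + 2) (by omega) (by omega))
    · rw [e3 i hij]; exact h.inner (i + 2) (by omega) (by omega)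

lemma IsAlternating.move {n : ℕ} {x : ℕ → G} (h : IsAlternating H K N T n x) (hN : H ⊓ K ≤ N)
    {i : ℕ} (hi : i ≤ 2 * n) {t : G} (ht : t ∈ H ⊓ K) :
    IsAlternating H K N T n (Function.update x (i + 1) (x (i + 1) * t)) := by
  have key : ∀ (S : Subgroup G) (k : ℕ), H ⊓ K ≤ S → (x k)⁻¹ * x (k + 1) ∈ S →
      (Function.update x (i + 1) (x (i + 1) * t) k)⁻¹ *
        Function.update x (i + 1) (x (i + 1) * t) (k + 1) ∈ S := by
    intro S k hS hk
    by_cases h1 : k = i + 1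
    · subst h1
      rw [Function.update_self, Function.update_of_ne (by omega), mul_inv_rev, mul_assoc]
      exact mul_mem (inv_mem (hS ht)) hk
    · by_cases h2 : k = i
      · subst h2
        rw [Function.update_self, Function.update_of_ne (by omega), ← mul_assoc]
        exact mul_mem hk (hS ht)
      · rwa [Function.update_of_ne h1, Function.update_of_ne (by omega)]
  refine ⟨?_, ?_, fun k hk => key _ k (inf_le_side k) (h.edge k hk),
    fun k h1 hk => key _ k hN (h.inner k h1 hk)⟩
  · rw [Function.update_of_ne (by omega)]; exact h.zero
  · rw [Function.update_of_ne (by omega)]; exact h.last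

/-- Among the alternating words with value in `T` take a shortest one, and one with the shortest
path among these. -/
lemma exists_minimal_isAlternating (d : G → G → ℕ) (hN : H ⊓ K ≤ N)
    (hex : ∃ n x, IsAlternating H K N T n x) :
    ∃ n x, IsAlternating H K N T n x ∧
      (∀ x', IsAlternating H K N T n x' →
        ∀ j, 1 ≤ j → j ≤ 2 * n → (x' j)⁻¹ * x' (j + 1) ∉ H ⊓ K) ∧
      ∀ i ≤ 2 * n, ∀ t ∈ H ⊓ K, d (x i) (x (i + 1)) + d (x (i + 1)) (x (i + 2)) ≤
        d (x i) (x (i + 1) * t) + d (x (i + 1) * t) (x (i + 2)) := by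
  classical
  let n := Nat.find hex
  have hn : ∃ x, IsAlternating H K N T n x := Nat.find_spec hex
  let cost : (ℕ → G) → ℕ := fun x => ∑ i ∈ Finset.range (2 * n + 2), d (x i) (x (i + 1))
  obtain ⟨x, hx, hmin⟩ := exists_minimalFor_of_wellFoundedLT
    (fun x => IsAlternating H K N T n x) cost hn
  refine ⟨n, x, hx, fun x' hx' j h1 hj hD => ?_, fun i hi t ht => ?_⟩
  · obtain ⟨m, hm, hm'⟩ := hx'.exists_shorter h1 hj hD
    exact Nat.find_min hex hm hm'
  · have hx' := hx.move hN hi ht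
    have hle : cost x ≤ cost (Function.update x (i + 1) (x (i + 1) * t)) :=
      (le_total _ _).elim id fun h => hmin hx' h
    obtain ⟨r, hr⟩ := Nat.exists_eq_add_of_le hi
    simp only [cost] at hle
    rw [show 2 * n + 2 = i + (2 + r) by omega, Finset.sum_range_add, Finset.sum_range_add,
      Finset.sum_range_add, Finset.sum_range_add] at hle
    have s1 : ∑ k ∈ Finset.range i, d (Function.update x (i + 1) (x (i + 1) * t) k)
        (Function.update x (i + 1) (x (i + 1) * t) (k + 1)) =
        ∑ k ∈ Finset.range i, d (x k) (x (k + 1)) := by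
      refine Finset.sum_congr rfl fun k hk => ?_
      have := Finset.mem_range.mp hk
      rw [Function.update_of_ne (by omega), Function.update_of_ne (by omega)]
    have s2 : ∑ k ∈ Finset.range r, d (Function.update x (i + 1) (x (i + 1) * t) (i + (2 + k)))
        (Function.update x (i + 1) (x (i + 1) * t) (i + (2 + k) + 1)) =
        ∑ k ∈ Finset.range r, d (x (i + (2 + k))) (x (i + (2 + k) + 1)) := by
      refine Finset.sum_congr rfl fun k hk => ?_
      rw [Function.update_of_ne (by omega), Function.update_of_ne (by omega)]
    rw [s1, s2] at hle
    simp only [Finset.sum_range_succ, Finset.sum_range_zero, zero_add, add_zero,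
      Function.update_self] at hle
    rw [Function.update_of_ne (by omega), Function.update_of_ne (by omega)] at hle
    simp only [add_assoc, Nat.reduceAdd] at hle
    omega

end Alternating

/-! ### The combination theorem -/

section Combination

variable {d : G → G → ℕ} {δ c : ℕ} {H K N : Subgroup G} {T : Set G}

/-- Paths with edges in `H` and `K` that are tight at their corner have Gromov product at most `c`
there. -/
def CornerBound (d : G → G → ℕ) (H K : Subgroup G) (c : ℕ) : Prop :=
  ∀ p v q, v⁻¹ * p ∈ H → v⁻¹ * q ∈ K →
    (∀ t ∈ H ⊓ K, d p v + d v q ≤ d p (v * t) + d (v * t) q) → d p v + d v q ≤ d p q + c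

/-- The elements of `N` in `H` and in `K` are long, up to those in `H ⊓ K`. -/
def LongOutside (d : G → G → ℕ) (H K N : Subgroup G) (b : ℕ) : Prop :=
  ∀ a ∈ N, a ∈ H ∨ a ∈ K → 2 * d 1 a ≤ b → a ∈ H ⊓ K

/-- A short inner letter would lie in `H ⊓ K` and could be absorbed. The second conclusion covers
all words with this `n`, because the main argument alters the word. -/
lemma exists_broken_isAlternating (hd : HypDist d δ) (hc : CornerBound d H K c) (hN : H ⊓ K ≤ N)
    (hlong : LongOutside d H K N (2 * c + 3 * δ)) (hex : ∃ n x, IsAlternating H K N T n x) :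
    ∃ n x, IsAlternating H K N T n x ∧
      (∀ x', IsAlternating H K N T n x' →
        ∀ j, 1 ≤ j → j ≤ 2 * n → (x' j)⁻¹ * x' (j + 1) ∉ H ⊓ K) ∧
      IsBroken d δ c (2 * n + 2) x := by
  obtain ⟨n, x, hx, hout, htight⟩ := exists_minimal_isAlternating d hN hex
  refine ⟨n, x, hx, hout, fun k hk => ?_, fun k h1 hk => ?_⟩
  · have ht := htight k (by omega)
    have e1 := hx.edge k (by omega)
    have e2 := hx.edge (k + 1) (by omega)
    have e1' := inv_mem e1
    rw [mul_inv_rev, inv_inv] at e1'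
    rcases Nat.even_or_odd' k with ⟨i, rfl | rfl⟩
    · rw [side_two_mul] at e1'
      rw [side_two_mul_add_one] at e2
      exact hc _ _ _ e1' e2 ht
    · rw [side_two_mul_add_one] at e1'
      rw [add_assoc, side_add_two, side_two_mul] at e2
      -- Here the `K`-edge comes first, so the corner is read backwards.
      have := hc _ _ _ e2 e1' (fun t htD => by
        have := ht t htD
        simp only [add_assoc, Nat.reduceAdd] at this ⊢
        rw [hd.comm (x (2 * i + 3)) (x (2 * i + 2)), hd.comm (x (2 * i + 2)) (x (2 * i + 1)),
          hd.comm (x (2 * i + 3)), hd.comm _ (x (2 * i + 1))]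
        omega)
      simp only [add_assoc, Nat.reduceAdd] at this ⊢
      rw [hd.comm (x (2 * i + 3)) (x (2 * i + 2)), hd.comm (x (2 * i + 2)) (x (2 * i + 1)),
        hd.comm (x (2 * i + 3)) (x (2 * i + 1))] at this
      omega
  · by_contra hle
    refine hout x hx k h1 (by omega) (hlong _ (hx.inner k h1 (by omega)) ?_ ?_)
    · have := hx.edge k (by omega)
      unfold side at this
      split_ifs at this
      exacts [Or.inl this, Or.inr this]
    · rw [← hd.mul_left (x k), mul_one, mul_inv_cancel_left]
      omega

/-- Suitable subgroups of finite index of two quasiconvex subgroups generate a quasiconvex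
subgroup. -/
lemma CoarseQC.sup_inf (hd : HypDist d δ) (hc : CornerBound d H K c) (hN : H ⊓ K ≤ N)
    (hlong : LongOutside d H K N (2 * c + 3 * δ)) (hH : CoarseQC d ((H ⊓ N : Subgroup G) : Set G))
    (hK : CoarseQC d ((K ⊓ N : Subgroup G) : Set G)) :
    CoarseQC d (((H ⊓ N) ⊔ (K ⊓ N) : Subgroup G) : Set G) := by
  have hle : H ⊓ K ≤ (H ⊓ N) ⊓ (K ⊓ N) := le_inf (le_inf inf_le_left hN) (le_inf inf_le_right hN)
  have hge : (H ⊓ N) ⊓ (K ⊓ N) ≤ H ⊓ K := inf_le_inf inf_le_left inf_le_left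
  -- Intersecting with `N` does not change `H ⊓ K`, so a constant `c` chosen before `N` still
  -- serves.
  have hc' : CornerBound d (H ⊓ N) (K ⊓ N) c := fun p v q hp hq hmin =>
    hc p v q hp.1 hq.1 fun t ht => hmin t (hle ht)
  have hlong' : LongOutside d (H ⊓ N) (K ⊓ N) N (2 * c + 3 * δ) := fun a ha hor hl =>
    hle (hlong a ha (hor.imp And.left And.left) hl)
  obtain ⟨r₁, h₁⟩ := hH (c + 6 * δ)
  obtain ⟨r₂, h₂⟩ := hK (c + 6 * δ)
  refine hd.coarseQC_of_between (r := max r₁ r₂) fun u hu v hv w hw => ?_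
  obtain ⟨n, x, hx, -, hb⟩ := exists_broken_isAlternating (T := {u⁻¹ * v}) hd hc'
    (hge.trans hN) hlong' (exists_isAlternating (h := 1) (k := 1) (z := u⁻¹ * v) (one_mem _)
      (one_mem _) (by simpa [inf_assoc] using mul_mem (inv_mem hu) hv) (by simp))
  have hside : ∀ i, side (H ⊓ N) (K ⊓ N) i ≤ (H ⊓ N) ⊔ (K ⊓ N) := by
    intro i
    unfold side
    split_ifs
    exacts [le_sup_left, le_sup_right]
  have hmem : ∀ i ≤ 2 * n + 2, x i ∈ (H ⊓ N) ⊔ (K ⊓ N) := by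
    intro i
    induction i with
    | zero => intro _; rw [hx.zero]; exact one_mem _
    | succ i ih =>
      intro hi
      have := mul_mem (ih (by omega)) (hside i (hx.edge i (by omega)))
      rwa [mul_inv_cancel_left] at this
  have hlast : x (2 * n + 2) = u⁻¹ * v := hx.last
  obtain ⟨k, hk, hkw⟩ := hb.exists_near_edge hd (by omega) (w := u⁻¹ * w) (by
    rw [hx.zero, hlast, hd.mul_left]
    have h1 := hd.mul_left u⁻¹ u w
    have h2 := hd.mul_left u⁻¹ u v
    rw [inv_mul_cancel] at h1 h2
    rw [h1, h2]
    exact hw)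
  obtain ⟨t, ht, htr⟩ : ∃ t ∈ side (H ⊓ N) (K ⊓ N) k,
      d ((x k)⁻¹ * (u⁻¹ * w)) t ≤ max r₁ r₂ := by
    have hmem := hx.edge k (by omega)
    have hle : d 1 ((x k)⁻¹ * (u⁻¹ * w)) + d ((x k)⁻¹ * (u⁻¹ * w)) ((x k)⁻¹ * x (k + 1)) ≤
        d 1 ((x k)⁻¹ * x (k + 1)) + (c + 6 * δ) := by
      have h1 := hd.mul_left (x k)⁻¹ (x k) (u⁻¹ * w)
      have h2 := hd.mul_left (x k)⁻¹ (x k) (x (k + 1))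
      rw [inv_mul_cancel] at h1 h2
      rw [h1, h2, hd.mul_left]
      exact hkw
    unfold side at hmem ⊢
    split_ifs at hmem ⊢
    · obtain ⟨t, ht, h⟩ := h₁ 1 (one_mem _) _ hmem _ hle
      exact ⟨t, ht, h.trans (le_max_left _ _)⟩
    · obtain ⟨t, ht, h⟩ := h₂ 1 (one_mem _) _ hmem _ hle
      exact ⟨t, ht, h.trans (le_max_right _ _)⟩
  refine ⟨u * (x k * t), mul_mem hu (mul_mem (hmem k hk.le) (hside k ht)), ?_⟩
  rwa [hd.inv_mul, hd.inv_mul] at htr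

lemma IsAlternating.replace {n : ℕ} {x : ℕ → G} (h : IsAlternating H K N T n x) (hN : H ⊓ K ≤ N)
    {j : ℕ} (hj : j ≤ 2 * n) {t : G} (ht : t ∈ H ⊓ K)
    (hT : x j * t * (x (j + 1))⁻¹ * x (2 * n + 2) ∈ T) :
    ∃ x', IsAlternating H K N T n x' ∧ (x' j)⁻¹ * x' (j + 1) = t := by
  let x' : ℕ → G := fun i => if i ≤ j then x i else x j * t * (x (j + 1))⁻¹ * x i
  have e1 : ∀ i, i ≠ j → (x' i)⁻¹ * x' (i + 1) = (x i)⁻¹ * x (i + 1) := by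
    intro i hi
    rcases Nat.lt_or_gt_of_ne hi with hi | hi
    · simp only [x', if_pos hi.le, if_pos (show i + 1 ≤ j by omega)]
    · simp only [x', if_neg (show ¬ i ≤ j by omega), if_neg (show ¬ i + 1 ≤ j by omega)]
      group
  have e2 : (x' j)⁻¹ * x' (j + 1) = t := by
    simp [x', mul_assoc]
  refine ⟨x', ⟨by simp [x', h.zero], ?_, fun i hi => ?_, fun i h1 hi => ?_⟩, e2⟩
  · simpa only [x', if_neg (show ¬ 2 * n + 2 ≤ j by omega)] using hT
  · by_cases hij : i = j
    · subst hij; rw [e2]; exact inf_le_side i ht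
    · rw [e1 i hij]; exact h.edge i hi
  · by_cases hij : i = j
    · subst hij; rw [e2]; exact hN ht
    · rw [e1 i hij]; exact h.inner i h1 hi

end Combination

/-! ### Separability and the induction -/

section Separable

lemma isSeparableSubset_iff {P : Set G} : IsSeparableSubset P ↔
    ∀ g ∉ P, ∃ N : Subgroup G, N.Normal ∧ N.FiniteIndex ∧ ∀ n ∈ N, g * n ∉ P :=
  (@isOpen_compl_iff G P (profiniteTopology G)).symm

lemma IsSeparableSubset.mul_left {P : Set G} (hP : IsSeparableSubset P) (a : G) :
    IsSeparableSubset ({a} * P) := by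
  rw [isSeparableSubset_iff] at hP ⊢
  intro g hg
  obtain ⟨N, h1, h2, h⟩ := hP (a⁻¹ * g) fun h => hg (by simpa using h)
  exact ⟨N, h1, h2, fun n hn hmem => h n hn (by simpa [mul_assoc] using hmem)⟩

lemma IsSeparableSubset.mul_right {P : Set G} (hP : IsSeparableSubset P) (b : G) :
    IsSeparableSubset (P * {b}) := by
  rw [isSeparableSubset_iff] at hP ⊢
  intro g hg
  obtain ⟨N, h1, h2, h⟩ := hP (g * b⁻¹) fun h => hg (by simpa using h)
  refine ⟨N, h1, h2, fun n hn hmem => h (b * n * b⁻¹) (h1.conj_mem n hn b) ?_⟩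
  simpa [mul_assoc] using hmem

lemma IsSeparableSubset.biUnion {ι : Type*} {S : Set ι} (hS : S.Finite) {P : ι → Set G}
    (h : ∀ i ∈ S, IsSeparableSubset (P i)) : IsSeparableSubset (⋃ i ∈ S, P i) :=
  @Set.Finite.isClosed_biUnion G ι (profiniteTopology G) S P hS h

lemma isSeparableSubset_of_forall_exists {P : Set G}
    (h : ∀ g ∉ P, ∃ F, IsSeparableSubset F ∧ P ⊆ F ∧ g ∉ F) : IsSeparableSubset P := by
  rw [isSeparableSubset_iff]
  intro g hg
  obtain ⟨F, hF, hsub, hgF⟩ := h g hg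
  obtain ⟨N, h1, h2, h⟩ := isSeparableSubset_iff.mp hF g hgF
  exact ⟨N, h1, h2, fun n hn hmem => h n hn (hsub hmem)⟩

/-- If `X D` is separable for each set `X` of a finite family, then a subgroup of finite index that
contains `D` is disjoint from those `X` that are disjoint from `D`. -/
lemma exists_finiteIndex_of_separable {ι : Type*} {S : Set ι} (hS : S.Finite) (D : Subgroup G)
    (X : ι → Set G) (hX : ∀ i ∈ S, IsSeparableSubset (X i * (D : Set G))) :
    ∃ N : Subgroup G, N.FiniteIndex ∧ D ≤ N ∧
      ∀ i ∈ S, (∃ x ∈ X i, x ∈ N) → ∃ x ∈ X i, x ∈ D := by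
  induction S, hS using Set.Finite.induction_on with
  | empty => exact ⟨⊤, inferInstance, le_top, by simp⟩
  | @insert i S hi _ ih =>
    obtain ⟨N, hNf, hDN, hN⟩ := ih fun j hj => hX j (Set.mem_insert_of_mem _ hj)
    by_cases hD : ∃ x ∈ X i, x ∈ D
    · refine ⟨N, hNf, hDN, ?_⟩
      rintro j (rfl | hj) h
      exacts [hD, hN j hj h]
    -- As `X i` misses `D`, `1 ∉ X i * D`. A normal `M` that misses `X i * D` gives `M ⊔ D = M D`,
    -- which misses `X i`.
    obtain ⟨M, hMn, hMf, hM⟩ := isSeparableSubset_iff.mp (hX i (Set.mem_insert _ _)) 1 (by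
      rintro ⟨x, hx, t, ht, hxt⟩
      refine hD ⟨x, hx, ?_⟩
      rw [eq_inv_of_mul_eq_one_left hxt]
      exact inv_mem ht)
    have hMD : (M ⊔ D).FiniteIndex := Subgroup.finiteIndex_of_le le_sup_left
    refine ⟨N ⊓ (M ⊔ D), inferInstance, le_inf hDN le_sup_right, ?_⟩
    rintro j (rfl | hj) ⟨x, hx, hxN⟩
    · obtain ⟨m, hm, t, ht, rfl⟩ := Subgroup.mem_sup_of_normal_left.mp hxN.2
      exact absurd (Set.mem_mul.mpr ⟨_, hx, t⁻¹, inv_mem ht, by simp⟩) (hM m hm)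
    · exact hN j hj ⟨x, hx, hxN.1⟩

/-- Representatives in `H` of the cosets of `H ⊓ N` in `H`. -/
lemma exists_finite_transversal (H N : Subgroup G) [N.FiniteIndex] :
    ∃ S : Set G, S.Finite ∧ S ⊆ H ∧ ∀ h ∈ H, ∃ s ∈ S, s⁻¹ * h ∈ H ⊓ N := by
  classical
  let f : G ⧸ N → G := fun q => if h : ∃ a ∈ H, (a : G ⧸ N) = q then h.choose else 1
  have hf : ∀ q, f q ∈ H := by
    intro q
    by_cases h : ∃ a ∈ H, (a : G ⧸ N) = q
    · simp only [f, dif_pos h]; exact h.choose_spec.1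
    · simp only [f, dif_neg h]; exact one_mem _
  refine ⟨Set.range f, Set.finite_range f, ?_, fun h hh =>
    ⟨f h, ⟨_, rfl⟩, Subgroup.mem_inf.mpr ⟨?_, ?_⟩⟩⟩
  · rintro _ ⟨q, rfl⟩
    exact hf q
  · exact mul_mem (inv_mem (hf _)) hh
  · have hex : ∃ a ∈ H, (a : G ⧸ N) = h := ⟨h, hh, rfl⟩
    rw [← QuotientGroup.eq]
    simp only [f, dif_pos hex]
    exact hex.choose_spec.2

lemma singleton_mul_subgroupProd (k : G) (l : List (Subgroup G)) :
    {k} * subgroupProd l =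
      subgroupProd (l.map fun H => H.map (MulAut.conj k).toMonoidHom) * {k} := by
  induction l with
  | nil => simp
  | cons H l ih =>
    have : {k} * (H : Set G) = (H.map (MulAut.conj k).toMonoidHom : Set G) * {k} := by
      ext x
      simp only [Set.singleton_mul, Set.mul_singleton, Set.mem_image]
      constructor
      · rintro ⟨y, hy, rfl⟩
        exact ⟨k * y * k⁻¹, mem_map_conj.mpr (by simpa [mul_assoc] using hy), by simp⟩
      · rintro ⟨y, hy, rfl⟩
        exact ⟨k⁻¹ * y * k, mem_map_conj.mp hy, by simp [mul_assoc]⟩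
    rw [List.map_cons, subgroupProd_cons, subgroupProd_cons, ← mul_assoc, this, mul_assoc, ih,
      mul_assoc]

variable {d : G → G → ℕ} {δ : ℕ}

lemma isSeparableSubset_mul_mul (hd : HypDist d δ) {H K : Subgroup G} {l : List (Subgroup G)}
    (hH : CoarseQC d (H : Set G)) (hK : CoarseQC d (K : Set G))
    (hl : ∀ Q ∈ l, CoarseQC d (Q : Set G))
    (ih : ∀ l' : List (Subgroup G), l'.length ≤ l.length + 1 →
      (∀ Q ∈ l', CoarseQC d (Q : Set G)) → IsSeparableSubset (subgroupProd l')) :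
    IsSeparableSubset ((H : Set G) * ((K : Set G) * subgroupProd l)) := by
  refine isSeparableSubset_of_forall_exists fun g hg => ?_
  obtain ⟨c, hc⟩ : ∃ c, CornerBound d H K c := hd.exists_backtrack_bound hH hK
  -- The defect `c + 2 * δ` comes from `IsBroken.between`; moving the base point from `1` to `g`
  -- adds `2 * d 1 g`.
  obtain ⟨R, hR⟩ := hd.exists_two_near_sides l hl (c + 2 * δ + 2 * d 1 g)
  have hball := hd.finite_ball (max R (2 * c + 3 * δ))
  let X : List (Subgroup G) × G × G → Set G := fun i => {x | i.2.1 * x * i.2.2⁻¹ ∈ subgroupProd i.1}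
  obtain ⟨N, hNf, hDN, hN⟩ := exists_finiteIndex_of_separable
    ((finite_sublists l).prod (hball.prod hball)) (H ⊓ K) X (by
      rintro ⟨mid, a, b⟩ ⟨hmid, -⟩
      -- Conjugating `H ⊓ K` by `b` leaves a product of at most `l.length + 1` subgroups, within
      -- reach of induction.
      have h1 : X (mid, a, b) * ((H ⊓ K : Subgroup G) : Set G) =
          {a⁻¹} * (subgroupProd (mid ++ [(H ⊓ K).map (MulAut.conj b).toMonoidHom]) * {b}) := by
        have h2 : X (mid, a, b) = {a⁻¹} * (subgroupProd mid * {b}) := by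
          ext x
          simp [X]
        have h3 := singleton_mul_subgroupProd b [H ⊓ K]
        simp only [List.map_cons, List.map_nil] at h3
        rw [h2, subgroupProd_append, mul_assoc, mul_assoc, mul_assoc, ← h3]
        simp
      rw [h1]
      refine ((ih _ ?_ ?_).mul_right b).mul_left a⁻¹
      · have : mid.length ≤ l.length := List.Sublist.length_le hmid
        simpa using this
      · intro Q hQ
        rcases List.mem_append.mp hQ with hQ | hQ
        · exact hl Q (List.Sublist.subset hmid hQ)
        · rw [List.mem_singleton.mp hQ]
          exact (hH.inf hd hK).map_conj hd b)
  have hlong : LongOutside d H K N (2 * c + 3 * δ) := by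
    intro a ha _ hle
    -- For the empty list, `X` is the singleton `{a}`.
    obtain ⟨x, hx, hxD⟩ := hN ([], 1, a) ⟨List.nil_sublist l, by simp [hd.self], by
      exact (show d 1 a ≤ 2 * c + 3 * δ by omega).trans (le_max_right _ _)⟩ ⟨a, by simp [X], ha⟩
    obtain rfl : x = a := by simpa [X, mul_inv_eq_one] using hx
    exact hxD
  have hNqc := coarseQC_of_finiteIndex hd N
  have hL := CoarseQC.sup_inf hd hc hDN hlong (hH.inf hd hNqc) (hK.inf hd hNqc)
  obtain ⟨S, hSf, hSH, hS⟩ := exists_finite_transversal H N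
  obtain ⟨S', hSf', hSK, hS'⟩ := exists_finite_transversal K N
  refine ⟨⋃ i ∈ S ×ˢ S', {i.1} * ((((H ⊓ N) ⊔ (K ⊓ N) : Subgroup G) : Set G) *
    ({i.2⁻¹} * subgroupProd l)), ?_, ?_, ?_⟩
  · refine IsSeparableSubset.biUnion (hSf.prod hSf') fun i _ => IsSeparableSubset.mul_left ?_ _
    rw [singleton_mul_subgroupProd, ← mul_assoc, ← subgroupProd_cons]
    refine (ih _ (by simp) fun Q hQ => ?_).mul_right _
    rcases List.mem_cons.mp hQ with rfl | hQ
    · exact hL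
    · obtain ⟨Q', hQ', rfl⟩ := List.mem_map.mp hQ
      exact (hl Q' hQ').map_conj hd _
  · rintro _ ⟨h, hh, _, ⟨k, hk, q, hq, rfl⟩, rfl⟩
    obtain ⟨s, hs, hsh⟩ := hS h hh
    -- Decomposing `k⁻¹` puts the `N`-part of `k` on its left, next to that of `h`.
    obtain ⟨s', hs', hsk⟩ := hS' k⁻¹ (inv_mem hk)
    have hmem : s⁻¹ * h * (s'⁻¹ * k⁻¹)⁻¹ ∈ (H ⊓ N) ⊔ (K ⊓ N) :=
      mul_mem (Subgroup.mem_sup_left hsh) (Subgroup.mem_sup_right (inv_mem hsk))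
    refine Set.mem_biUnion (x := (s, s')) ⟨hs, hs'⟩ ?_
    refine Set.mem_mul.mpr ⟨s, rfl, _, Set.mem_mul.mpr ⟨_, hmem, _,
      Set.mem_mul.mpr ⟨s'⁻¹, rfl, q, hq, rfl⟩, rfl⟩, ?_⟩
    simp [mul_assoc]
  · intro hgF
    obtain ⟨⟨h, k⟩, ⟨hh, hk⟩, hmem⟩ := Set.mem_iUnion₂.mp hgF
    obtain ⟨_, rfl, _, ⟨z, hz, _, ⟨_, rfl, q, hq, rfl⟩, rfl⟩, hgq⟩ := hmem
    simp only at hgq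
    obtain ⟨n, x, hx, hout, hb⟩ := exists_broken_isAlternating
      (T := {y | y⁻¹ * g ∈ subgroupProd l}) hd hc hDN hlong
      (exists_isAlternating (hSH hh) (inv_mem (hSK hk)) hz (by
        simpa [← hgq, mul_assoc] using hq))
    rcases Nat.eq_zero_or_pos n with rfl | hn
    · refine hg ⟨x 1, ?_, _, ⟨(x 1)⁻¹ * x 2, ?_, (x 2)⁻¹ * g, hx.last, rfl⟩, by simp [mul_assoc]⟩
      · simpa [hx.zero, side] using hx.edge 0 (by omega)
      · simpa [side] using hx.edge 1 (by omega)
    · have b2 := hb.between hd (k := 2) (by omega)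
      have l1 := hb.left hd 0 (by omega)
      simp only [zero_add] at l1
      rw [hx.zero] at b2 l1
      have hgy := hd.tri 1 g (x (2 * n + 2))
      have hg2 := hd.tri g 1 (x 2)
      have hg1 := hd.tri g 1 (x 1)
      have hg3 := hd.tri 1 g (x 2)
      -- The polygon runs from the end of the word back to `g`, so `x 2` precedes `x 1` and the
      -- inverse letter appears.
      obtain ⟨pre, mid, suf, a, b, hmid, hsub, ha, hb', hpre, hmid', hsuf⟩ :=
        hR (x (2 * n + 2)) (x 2) (x 1) g hx.last
          (by
            rw [hd.comm _ (x 2), hd.comm _ g, hd.comm _ g]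
            rw [hd.comm g 1] at *
            omega)
          (by
            rw [hd.comm (x 2) (x 1), hd.comm _ g, hd.comm _ g]
            rw [hd.comm g 1] at *
            omega)
      obtain ⟨t, ht, htD⟩ := hN (mid, a, b)
        ⟨hmid, ha.trans (le_max_left _ _), hb'.trans (le_max_left _ _)⟩
        ⟨(x 2)⁻¹ * x 1, by simpa [X, mul_assoc] using hmid', by
          simpa using inv_mem (hx.inner 1 le_rfl (by omega))⟩
      -- With `t` in place of the inverse letter, the product still lies in `pre * mid * suf`, so
      -- the new word has the same `n` and its value stays in `T`.
      obtain ⟨x', hx', he⟩ := hx.replace hDN (j := 1) (by omega) (inv_mem htD) (by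
        refine hsub (Set.mem_mul.mpr ⟨_, hpre, _, Set.mem_mul.mpr ⟨_, ht, _, hsuf, rfl⟩, ?_⟩)
        group)
      exact hout x' hx' 1 le_rfl (by omega) (he ▸ inv_mem htD)

lemma isSeparableSubset_subgroupProd (hd : HypDist d δ)
    (hsep : ∀ H : Subgroup G, CoarseQC d (H : Set G) → IsSeparableSubset (H : Set G))
    (l : List (Subgroup G)) (hl : ∀ H ∈ l, CoarseQC d (H : Set G)) :
    IsSeparableSubset (subgroupProd l) := by
  induction hn : l.length using Nat.strong_induction_on generalizing l with
  | _ n ih =>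
    subst hn
    match l, hl, ih with
    | [], _, _ => simpa using hsep ⊥ hd.coarseQC_bot
    | [H], hl, _ => simpa using hsep H (hl H List.mem_cons_self)
    | H :: K :: l, hl, ih =>
      rw [subgroupProd_cons, subgroupProd_cons]
      refine isSeparableSubset_mul_mul hd (hl H (by simp)) (hl K (by simp))
        (fun Q hQ => hl Q (by simp [hQ])) fun l' hlen hl' => ih _ ?_ l' hl' rfl
      simp only [List.length_cons]
      omega

end Separable

end GFERF

theorem theorem1 {G : Type*} [Group G] (A : Set G) (hG : GFERF.IsGFERF A)
    (s : ℕ) (H : Fin s → Subgroup G)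
    (hH : ∀ i, GFERF.IsQuasiconvex A (H i : Set G)) :
    GFERF.IsSeparableSubset (List.ofFn fun i => (H i : Set G)).prod := by
  obtain ⟨δ, hd⟩ := hG.hyperbolic.exists_hypDist
  have hA := hG.hyperbolic.closure_eq_top
  have key := GFERF.isSeparableSubset_subgroupProd hd
    (fun K hK => hG.separable K (hK.isQuasiconvex hA)) (List.ofFn H) (by
      intro K hK
      obtain ⟨i, rfl⟩ := List.mem_ofFn.mp hK
      exact (hH i).coarseQC hA hd)
  rwa [GFERF.subgroupProd, List.map_ofFn] at key
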